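/- **Simulating 2-local commuting Hamiltonians.** For integers $b\ge n\ge 2$ and real coefficients $\beta=(\beta_{jk})_{1\le j<k\le n}$ let $H_\beta=\sum_{1\le j<k\le n}\beta_{jk}Z_jZ_k$ be the Hamiltonian on $n$ qubits, where $Z_j$ is the Pauli-$Z$ operator on qubit $j$. Let $\mathcal K$ be a set of unitary $2$-qubit gates. A $b$-qubit circuit of at most $g$ gates from $\mathcal K$ is a product $V$ of at most $g$ operators, each of which is an element of $\mathcal K$ acting on an ordered pair of distinct qubits out of $b$ and trivially on the others. For $t,\varepsilon>0$ let $g_{\mathcal K}(n,b,t,\varepsilon)\in\mathbb N\cup\{\infty\}$ be the least $g$ such that for every $\beta$ with $|\beta_{jk}|\le t$ for all $j<k$ there is a $b$-qubit circuit $V$ of at most $g$ gates from $\mathcal K$ with $$\|e^{-iH_\beta}\otimes I_{b-n}-V\|\le\varepsilon$$ in the spectral norm, where $I_{b-n}$ is the identity on the last $b-n$ qubits (and $g_{\mathcal K}=\infty$ if there is no such $g$). Let $g^{0}_{\mathcal K}(n,b,t,\varepsilon)$ be the analogous number when the last $b-n$ qubits are ancillas initialized in $|0\cdots0\rangle$,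 that is, when the condition is only $\|Je^{-iH_\beta}-VJ\|\le\varepsilon$ with $J|\psi\rangle=|\psi\rangle\otimes|0\cdots 0\rangle$. Then for every $a>0$ there are constants $c,C>0$ and $r\in\mathbb N$, depending only on $a$, such that for all $b\ge n\ge2$, all $0<\varepsilon<1/3$ and all $t\ge a\varepsilon$: 1. for every finite non-empty set $\mathcal K$ of $2$-qubit gates, both $g_{\mathcal K}(n,b,t,\varepsilon)$ and $g^{0}_{\mathcal K}(n,b,t,\varepsilon)$ are at least $$c\left(\frac{n^2}{\log(b|\mathcal K|)}-C\,n\log^{r}\!\left(\frac n\varepsilon\right)\right);$$ 2. for $\mathcal K$ the set of all $2$-qubit gates, both $g_{\mathcal K}(n,b,t,\varepsilon)$ and $g^{0}_{\mathcal K}(n,b,t,\varepsilon)$ are at least $$c\left(\frac{n^2}{\log b}-C\,n\log^{r}\!\left(\frac n\varepsilon\right)\right).$$ -/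

import Mathlib

namespace QCircuit

/-- Labels `x ∈ {0,1}^m` of the computational basis states of `m` qubits. -/
abbrev Bits (m : ℕ) : Type := Fin m → Fin 2

/-- Operators on `m` qubits, as matrices in the computational basis. -/
abbrev Op (m : ℕ) : Type := Matrix (Bits m) (Bits m) ℂ

/-- The Pauli operator `Z` on qubit `j`: `Z_j |x⟩ = (-1)^{x_j} |x⟩`. -/
def pauliZ {m : ℕ} (j : Fin m) : Op m :=
  Matrix.diagonal fun x => (-1 : ℂ) ^ (x j : ℕ)

/-- The Hamiltonian `H = ∑_{j < k} β_{jk} Z_j Z_k` on `n` qubits. Only the entries of `β` above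
the diagonal are used. -/
def hamiltonian {n : ℕ} (β : Fin n → Fin n → ℝ) : Op n :=
  ∑ j : Fin n, ∑ k ∈ Finset.Ioi j, (β j k : ℂ) • (pauliZ j * pauliZ k)

/-- The evolution operator `e^{-iH}`. -/
noncomputable def evolution {n : ℕ} (β : Fin n → Fin n → ℝ) : Op n :=
  NormedSpace.exp ((-Complex.I) • hamiltonian β)

/-- The `m`-qubit operator `U` acting on the qubits `q 0, …, q (m - 1)` of a `b`-qubit register,
tensored with the identity on all the other qubits. -/
def actOn {m b : ℕ} (q : Fin m ↪ Fin b) (U : Op m) : Op b :=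
  Matrix.of fun x y =>
    if ∀ i : Fin b, (∀ j : Fin m, q j ≠ i) → x i = y i then U (x ∘ q) (y ∘ q) else 0

/-- A unitary `2`-qubit gate. -/
abbrev TwoQubitGate : Type := Matrix.unitaryGroup (Bits 2) ℂ

/-- A `2`-qubit gate together with the ordered pair of distinct qubits, of a `b`-qubit register,
on which it acts. -/
structure PlacedGate (b : ℕ) where
  qubits : Fin 2 ↪ Fin b
  gate : TwoQubitGate

/-- The operator performed by a circuit, a finite sequence of placed gates; its gate count is the
length of the sequence. -/
noncomputable def circuitOp {b : ℕ} (L : List (PlacedGate b)) : Op b :=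
  (L.map fun G => actOn G.qubits (G.gate : Op 2)).prod

/-- The operators performed by `b`-qubit circuits of at most `g` gates, all from the set `K`. -/
def circuits (K : Set TwoQubitGate) (b g : ℕ) : Set (Op b) :=
  {V | ∃ L : List (PlacedGate b), L.length ≤ g ∧ (∀ G ∈ L, G.gate ∈ K) ∧ circuitOp L = V}

/-- The isometry `|ψ⟩ ↦ |ψ⟩ ⊗ |0…0⟩` from `n` qubits to `b ≥ n` qubits. -/
def zeroAncilla {n b : ℕ} (hb : n ≤ b) : Matrix (Bits b) (Bits n) ℂ :=
  Matrix.of fun x y =>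
    if x ∘ Fin.castLE hb = y ∧ ∀ i : Fin b, n ≤ (i : ℕ) → x i = 0 then 1 else 0

section Norm

open scoped Matrix.Norms.L2Operator

/-- The operator norm, i.e. spectral norm (largest singular value). -/
noncomputable def opNorm {m n : ℕ} (A : Matrix (Bits m) (Bits n) ℂ) : ℝ := ‖A‖

end Norm

/-- The gate counts `g` such that for every Hamiltonian with coefficients in `[-t, t]` there is a
`b`-qubit circuit `V` of at most `g` gates from `K` with `‖e^{-iH} - V‖ ≤ ε`, where `e^{-iH}` acts
on the first `n` qubits and trivially on the remaining `b - n`. -/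
def sufficientGates (K : Set TwoQubitGate) {n b : ℕ} (hb : n ≤ b) (t ε : ℝ) : Set ℕ :=
  {g | ∀ β : Fin n → Fin n → ℝ, (∀ j k, j < k → |β j k| ≤ t) →
    ∃ V ∈ circuits K b g, opNorm (actOn (Fin.castLEEmb hb) (evolution β) - V) ≤ ε}

/-- The same, where the last `b - n` qubits are ancillas that start in `|0…0⟩` (and have to be
returned to it), so that `V` has to approximate `e^{-iH}` only on the states `|ψ⟩ ⊗ |0…0⟩`. -/
def sufficientGatesAncilla (K : Set TwoQubitGate) {n b : ℕ} (hb : n ≤ b) (t ε : ℝ) : Set ℕ :=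
  {g | ∀ β : Fin n → Fin n → ℝ, (∀ j k, j < k → |β j k| ≤ t) →
    ∃ V ∈ circuits K b g,
      opNorm (zeroAncilla hb * evolution β - V * zeroAncilla hb) ≤ ε}

end QCircuit

/-!
The lower bound is a counting argument: `m ^ 2` bits, with `m` proportional to `n`, can be encoded
in the Hamiltonian and read off from any circuit that simulates it, while a circuit with `g` gates
has only `O(g log b)` bits of freedom.

*Encoding.* The qubits are divided into blocks of `2 L` qubits, with `L` of order `1 / a`. A bit
`M (J, K)` is encoded in a coupling of strength at most `a ε`, with alternating signs, between the
blocks `J` and `m + K` (`blockCoupling`). Because of the signs, flipping the even qubits of these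
two blocks gives a basis state whose energy is `2 π ε` if the bit is set and `0` otherwise, whatever
the other bits are (`energy_blockCoupling_testBits`). So one diagonal entry of the circuit operator
is within `ε` of `1` or at distance at least `3 ε` from it, according to the bit. Only the entries
at states `|x⟩ ⊗ |0…0⟩` are used, so that ancillas make no difference
(`exists_circuits_with_tests`).

*Finite gate sets.* There are at most `(b² |K| + 1) ^ g` circuits (`card_le_of_finite_gates`).

*All gates.* The placements of the gates are chosen in at most `(b² + 1) ^ g` ways. For fixed
placements, the squared distances of the tested entries from `1` are `m ^ 2` polynomials of degree
`2 g` in the `32 g` real and imaginary parts of the entries of the gates, and the bits are the signs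
of these polynomials minus `4 ε²`. A Warren-type bound (`card_le_of_sign_patterns`) on the number
of sign patterns thus leaves `O(g log b)` bits, for every `ε`.

The bound on sign patterns needs no real algebraic geometry. For a small vector `c`, every cell of
the sign conditions contains a point at which the gradient of `(R - |x|²) ∏ p_i` is `c`
(`exists_gradient_eq_of_cell`), so it suffices to bound a generic fibre of a polynomial map
`f : ℝ ^ N → ℝ ^ N` of degree `D`. By a count of dimensions, each linear form `y` satisfies a
polynomial equation of degree at most `(D N + 1) ^ N` over `f` (`exists_polynomial_relation`); its
coefficients do not all vanish at a generic `c`, and a form `y` that is injective on the given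
points of the fibre then bounds their number (`exists_card_fiber_le`).
-/

namespace QCircuit

/-! ### Generic fibres of polynomial maps -/

open MvPolynomial in
theorem totalDegree_pderiv_le {σ : Type*} (i : σ) (p : MvPolynomial σ ℝ) :
    (pderiv i p).totalDegree ≤ p.totalDegree := by
  classical
  conv_lhs => rw [p.as_sum, map_sum]
  refine totalDegree_finsetSum_le fun s hs => ?_
  rw [pderiv_monomial]
  refine (totalDegree_monomial_le _ _).trans (le_trans ?_ (le_totalDegree hs))
  have h : s - Finsupp.single i 1 ≤ s := tsub_le_self
  exact Finsupp.degree_mono h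

open MvPolynomial in
theorem hasDerivAt_eval_line {σ : Type*} [DecidableEq σ] (p : MvPolynomial σ ℝ) (x : σ → ℝ)
    (j : σ) :
    HasDerivAt (fun t : ℝ => eval (x + t • Pi.single j 1) p) (eval x (pderiv j p)) 0 := by
  induction p using MvPolynomial.induction_on with
  | C a => simpa using hasDerivAt_const (0 : ℝ) a
  | add p q hp hq => simpa using hp.fun_add hq
  | mul_X p k hp =>
    have hX : HasDerivAt (fun t : ℝ => eval (x + t • Pi.single j (1 : ℝ)) (X k))
        (eval x (pderiv j (X k))) 0 := by
      by_cases h : k = j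
      · subst h
        simpa using (hasDerivAt_id (0 : ℝ)).const_add (x k)
      · simpa [pderiv_X_of_ne h, h] using hasDerivAt_const (0 : ℝ) (x k)
    have := hp.fun_mul hX
    simp only [zero_smul, add_zero] at this
    simp only [map_mul, Derivation.leibniz, smul_eq_mul, map_add]
    convert! this using 1
    ring

open MvPolynomial in
/-- A polynomial relation found by counting dimensions: the monomials `y ^ i * ∏ f_j ^ α_j` with
all exponents at most `E = (D N + 1) ^ N` outnumber the points of a grid on which a polynomial of
their degree is determined. -/
theorem exists_polynomial_relation {σ : Type*} [Fintype σ] (f : σ → MvPolynomial σ ℝ) (D : ℕ)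
    (hf : ∀ j, (f j).totalDegree ≤ D) (y : MvPolynomial σ ℝ) (hy : y.totalDegree ≤ 1) :
    ∃ a : Fin ((D * Fintype.card σ + 1) ^ Fintype.card σ + 1) → MvPolynomial σ ℝ, a ≠ 0 ∧
      ∀ x, ∑ i, eval (fun j => eval x (f j)) (a i) *
        eval x y ^ (i : ℕ) = 0 := by
  classical
  set N := Fintype.card σ with hN
  set E := (D * N + 1) ^ N with hE
  set m := E + D * N * E with hm
  let term : Fin (E + 1) × (σ → Fin (E + 1)) → MvPolynomial σ ℝ := fun q =>
    (∏ j, f j ^ (q.2 j : ℕ)) * y ^ (q.1 : ℕ)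
  have hterm : ∀ q, (term q).totalDegree ≤ m := by
    intro q
    refine (totalDegree_mul _ _).trans ?_
    have h1 : (∏ j, f j ^ (q.2 j : ℕ)).totalDegree ≤ D * N * E := by
      refine (totalDegree_finsetProd _ _).trans ?_
      calc _ ≤ ∑ _j : σ, E * D := Finset.sum_le_sum fun j _ =>
            (totalDegree_pow _ _).trans (Nat.mul_le_mul (by have := (q.2 j).isLt; omega) (hf j))
        _ = D * N * E := by simp [hN]; ring
    have h2 : (y ^ (q.1 : ℕ)).totalDegree ≤ E := by
      refine (totalDegree_pow _ _).trans ?_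
      have := q.1.isLt
      nlinarith
    omega
  let Φ : (Fin (E + 1) × (σ → Fin (E + 1)) → ℝ) →ₗ[ℝ] ((σ → Fin (m + 1)) → ℝ) :=
    { toFun := fun v z => ∑ q, v q * eval (fun j => ((z j : ℕ) : ℝ)) (term q)
      map_add' := fun v w => by ext z; simp [add_mul, Finset.sum_add_distrib]
      map_smul' := fun r v => by ext z; simp [Finset.mul_sum, mul_assoc] }
  have hdim : Module.finrank ℝ ((σ → Fin (m + 1)) → ℝ) <
      Module.finrank ℝ (Fin (E + 1) × (σ → Fin (E + 1)) → ℝ) := by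
    simp only [Module.finrank_fintype_fun_eq_card, Fintype.card_prod, Fintype.card_fun,
      Fintype.card_fin, ← hN]
    calc (m + 1) ^ N ≤ ((D * N + 1) * (E + 1)) ^ N := Nat.pow_le_pow_left (by rw [hm]; nlinarith) _
      _ = E * (E + 1) ^ N := by rw [mul_pow]
      _ < (E + 1) * (E + 1) ^ N := Nat.mul_lt_mul_of_pos_right (by omega) (by positivity)
  obtain ⟨v, hv, hv0⟩ := (Submodule.ne_bot_iff _).1
    (LinearMap.ker_ne_bot_of_finrank_lt (f := Φ) hdim)
  have hP : (∑ q, C (v q) * term q) = 0 := by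
    refine eq_zero_of_eval_zero_at_prod_finset _
      (fun _ => (Finset.range (m + 1)).image (fun k : ℕ => (k : ℝ))) (fun i => ?_) fun x hx => ?_
    · rw [Finset.card_image_of_injective _ Nat.cast_injective, Finset.card_range, Nat.lt_succ_iff]
      refine (degreeOf_le_totalDegree _ _).trans (totalDegree_finsetSum_le fun q _ => ?_)
      refine (totalDegree_mul _ _).trans ?_
      simpa using hterm q
    · simp only [Finset.mem_image, Finset.mem_range] at hx
      choose z hz hzx using hx
      have := congrFun (LinearMap.mem_ker.1 hv) (fun j => ⟨z j, hz j⟩)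
      have hx' : (fun j => ((z j : ℕ) : ℝ)) = x := funext hzx
      simpa [Φ, hx'] using this
  let e : (σ → Fin (E + 1)) → σ →₀ ℕ := fun α => Finsupp.equivFunOnFinite.symm fun j => (α j : ℕ)
  have he : Function.Injective e := fun α β h => by
    ext j
    exact DFunLike.congr_fun h j
  refine ⟨fun i => ∑ α, monomial (e α) (v (i, α)), fun h => hv0 ?_, fun x => ?_⟩
  · ext ⟨i, α⟩
    have := congrArg (coeff (e α)) (congrFun h i)
    simpa [coeff_sum, coeff_monomial, he.eq_iff] using this
  · have := congrArg (eval x) hP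
    simp only [map_sum, map_zero, Fintype.sum_prod_type] at this
    rw [← this]
    refine Finset.sum_congr rfl fun i _ => ?_
    simp only [map_sum, Finset.sum_mul]
    refine Finset.sum_congr rfl fun α _ => ?_
    simp [term, eval_monomial, e, Finsupp.prod_fintype, mul_assoc]

open MvPolynomial in
/-- A weak form of Bézout's theorem: a generic fibre of a polynomial map of degree `D` from `ℝ ^ N`
to itself has at most `(D N + 1) ^ N` points. -/
theorem exists_card_fiber_le {σ : Type*} [Fintype σ] (f : σ → MvPolynomial σ ℝ) (D : ℕ)
    (hf : ∀ j, (f j).totalDegree ≤ D) :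
    ∃ B : MvPolynomial σ ℝ, B ≠ 0 ∧ ∀ c : σ → ℝ, eval c B ≠ 0 →
      ∀ S : Finset (σ → ℝ), (∀ z ∈ S, ∀ j, eval z (f j) = c j) →
        S.card ≤ (D * Fintype.card σ + 1) ^ Fintype.card σ := by
  classical
  set N := Fintype.card σ with hN
  set E := (D * N + 1) ^ N with hE
  let idx : σ ≃ Fin N := Fintype.equivFin σ
  let y : ℕ → MvPolynomial σ ℝ := fun κ => ∑ j, C ((κ : ℝ) ^ (idx j : ℕ)) * X j
  have hy : ∀ κ, (y κ).totalDegree ≤ 1 := fun κ =>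
    totalDegree_finsetSum_le fun j _ => (totalDegree_mul _ _).trans
      (by rw [totalDegree_C, totalDegree_X])
  choose a ha0 ha using fun κ => exists_polynomial_relation f D hf (y κ) (hy κ)
  choose i hi using fun κ => Function.ne_iff.1 (ha0 κ)
  refine ⟨∏ κ ∈ Finset.range ((E + 1) * (E + 1) * N + 1), a κ (i κ),
    Finset.prod_ne_zero_iff.2 fun κ _ => hi κ, fun c hc S hS => ?_⟩
  by_contra! hcard
  obtain ⟨T, hTS, hT⟩ := Finset.exists_subset_card_eq (n := E + 1) (s := S) hcard
  -- Some `y κ` with `κ` in the range is injective on `T`, as only few `κ` are roots of `W`.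
  let w : (σ → ℝ) × (σ → ℝ) → Polynomial ℝ := fun q =>
    ∑ j, Polynomial.monomial (idx j : ℕ) (q.1 j - q.2 j)
  have hw : ∀ q ∈ T.offDiag, w q ≠ 0 := by
    rintro ⟨s, t⟩ hq h0
    apply (Finset.mem_offDiag.1 hq).2.2
    ext j
    have := congrArg (fun p => Polynomial.coeff p (idx j : ℕ)) h0
    simp only [w, Polynomial.finsetSum_coeff, Polynomial.coeff_monomial, Polynomial.coeff_zero,
      Fin.val_inj, idx.injective.eq_iff, Finset.sum_ite_eq', Finset.mem_univ, if_true] at this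
    linarith
  have hwdeg : ∀ q, (w q).natDegree ≤ N := fun q =>
    Polynomial.natDegree_sum_le_of_forall_le _ _ fun j _ =>
      (Polynomial.natDegree_monomial_le _).trans (idx j).isLt.le
  let W := ∏ q ∈ T.offDiag, w q
  have hW : W ≠ 0 := Finset.prod_ne_zero_iff.2 hw
  have hWdeg : W.natDegree ≤ (E + 1) * (E + 1) * N := by
    refine (Polynomial.natDegree_prod_le _ _).trans ((Finset.sum_le_card_nsmul _ _ N
      fun q _ => hwdeg q).trans ?_)
    rw [smul_eq_mul, Finset.offDiag_card, hT]
    exact Nat.mul_le_mul_right _ (Nat.sub_le _ _)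
  obtain ⟨κ, hκ, hκW⟩ : ∃ κ ∈ Finset.range ((E + 1) * (E + 1) * N + 1),
      W.eval (κ : ℝ) ≠ 0 := by
    by_contra! h
    refine hW (Polynomial.eq_zero_of_natDegree_lt_card_of_eval_eq_zero' W
      ((Finset.range ((E + 1) * (E + 1) * N + 1)).image (fun k : ℕ => (k : ℝ))) ?_ ?_)
    · simpa using h
    · rw [Finset.card_image_of_injective _ Nat.cast_injective, Finset.card_range]
      omega
  have hinj : Set.InjOn (fun z : σ → ℝ => eval z (y κ)) T := by
    intro s hs t ht hst
    by_contra hne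
    refine hκW ?_
    rw [Polynomial.eval_prod]
    refine Finset.prod_eq_zero (i := (s, t)) (Finset.mem_offDiag.2 ⟨hs, ht, hne⟩) ?_
    simp only [y, map_sum, map_mul, eval_C, eval_X] at hst
    simp only [w, Polynomial.eval_finsetSum, Polynomial.eval_monomial, sub_mul,
      Finset.sum_sub_distrib]
    rw [sub_eq_zero]
    simpa only [mul_comm] using hst
  have hcκ : eval c (a κ (i κ)) ≠ 0 := by
    rw [map_prod, Finset.prod_ne_zero_iff] at hc
    exact hc κ hκ
  let Q : Polynomial ℝ := ∑ l : Fin (E + 1), Polynomial.monomial (l : ℕ) (eval c (a κ l))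
  have hQ0 : Q ≠ 0 := by
    intro h
    have := congrArg (fun p => Polynomial.coeff p (i κ : ℕ)) h
    simp only [Q, Polynomial.finsetSum_coeff, Polynomial.coeff_monomial, Polynomial.coeff_zero,
      Fin.val_inj, Finset.sum_ite_eq', Finset.mem_univ, if_true] at this
    exact hcκ this
  refine hQ0 (Polynomial.eq_zero_of_natDegree_lt_card_of_eval_eq_zero' Q
    (T.image fun z => eval z (y κ)) ?_ ?_)
  · intro r hr
    obtain ⟨z, hz, rfl⟩ := Finset.mem_image.1 hr
    have := ha κ z
    rw [show (fun j => eval z (f j)) = c from funext (hS z (hTS hz))] at this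
    simpa [Q, Polynomial.eval_finsetSum, Polynomial.eval_monomial] using this
  · rw [Finset.card_image_of_injOn hinj, hT, Nat.lt_succ_iff]
    exact Polynomial.natDegree_sum_le_of_forall_le _ _ fun l _ =>
      (Polynomial.natDegree_monomial_le _).trans (Nat.lt_succ_iff.1 l.isLt)

/-! ### Sign patterns of real polynomials -/

open MvPolynomial Filter Topology in
/-- On each cell of a polynomial sign condition, a polynomial `G` that vanishes on the walls of the
cell takes every sufficiently small vector as gradient: the extremum over the closed cell of `G`
minus a small linear form lies in the open cell. -/
theorem exists_gradient_eq_of_cell {σ ι : Type*} [Fintype σ] [Fintype ι]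
    (p : ι → MvPolynomial σ ℝ) (R : ℝ) (hR : 1 ≤ R) (x : σ → ℝ) (hx : ∀ i, eval x (p i) ≠ 0)
    (hxR : ∑ j, x j ^ 2 < R) (G : MvPolynomial σ ℝ)
    (hG : G = (C R - ∑ j, X j ^ 2) * ∏ i, p i) :
    ∃ δ > 0, ∀ c : σ → ℝ, (∀ j, |c j| ≤ δ) →
      ∃ z : σ → ℝ, (∀ i, 0 < eval z (p i) * eval x (p i)) ∧ ∀ j, eval z (pderiv j G) = c j := by
  classical
  have hGe : ∀ z, eval z G = (R - ∑ j, z j ^ 2) * ∏ i, eval z (p i) := fun z => by simp [hG]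
  have hGx : eval x G ≠ 0 := by
    rw [hGe]
    exact mul_ne_zero (sub_ne_zero.2 hxR.ne') (Finset.prod_ne_zero_iff.2 fun i _ => hx i)
  set γ := |eval x G| with hγ
  have hγ0 : 0 < γ := abs_pos.2 hGx
  set N : ℝ := (Fintype.card σ : ℝ) with hN
  have hN0 : 0 ≤ N := by positivity
  refine ⟨γ / (4 * (N * R + 1)), by positivity, fun c hc => ?_⟩
  let Ω : Set (σ → ℝ) := {z | ∑ j, z j ^ 2 < R ∧ ∀ i, 0 < eval z (p i) * eval x (p i)}
  let K : Set (σ → ℝ) := {z | ∑ j, z j ^ 2 ≤ R ∧ ∀ i, 0 ≤ eval z (p i) * eval x (p i)}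
  have hΩK : Ω ⊆ K := fun z hz => ⟨hz.1.le, fun i => (hz.2 i).le⟩
  have hsq : Continuous fun z : σ → ℝ => ∑ j, z j ^ 2 := by fun_prop
  have hΩ : IsOpen Ω := by
    refine (isOpen_lt hsq continuous_const).inter ?_
    have : {z : σ → ℝ | ∀ i, 0 < eval z (p i) * eval x (p i)} =
        ⋂ i, {z | 0 < eval z (p i) * eval x (p i)} := by ext; simp
    change IsOpen {z : σ → ℝ | ∀ i, 0 < eval z (p i) * eval x (p i)}
    rw [this]
    exact isOpen_iInter_of_finite fun i =>
      isOpen_lt continuous_const ((MvPolynomial.continuous_eval _).mul continuous_const)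
  have hbound : ∀ z ∈ K, ∀ j, |z j| ≤ R := by
    intro z hz j
    have h1 : z j ^ 2 ≤ R :=
      (Finset.single_le_sum (fun j _ => sq_nonneg (z j)) (Finset.mem_univ j)).trans hz.1
    refine abs_le_of_sq_le_sq (h1.trans ?_) (by linarith)
    nlinarith
  have hKc : IsCompact K := by
    refine (isCompact_Icc (a := fun _ : σ => -R) (b := fun _ => R)).of_isClosed_subset ?_ ?_
    · refine (isClosed_le hsq continuous_const).inter ?_
      have : {z : σ → ℝ | ∀ i, 0 ≤ eval z (p i) * eval x (p i)} =
          ⋂ i, {z | 0 ≤ eval z (p i) * eval x (p i)} := by ext; simp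
      change IsClosed {z : σ → ℝ | ∀ i, 0 ≤ eval z (p i) * eval x (p i)}
      rw [this]
      exact isClosed_iInter fun i =>
        isClosed_le continuous_const ((MvPolynomial.continuous_eval _).mul continuous_const)
    · exact fun z hz => ⟨fun j => (abs_le.1 (hbound z hz j)).1, fun j => (abs_le.1 (hbound z hz j)).2⟩
  have hxΩ : x ∈ Ω := ⟨hxR, fun i => mul_self_pos.2 (hx i)⟩
  have hsmall : ∀ z ∈ K, |∑ j, c j * z j| ≤ γ / 4 := by
    intro z hz
    calc |∑ j, c j * z j| ≤ ∑ j, |c j * z j| := Finset.abs_sum_le_sum_abs _ _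
      _ ≤ ∑ _j : σ, γ / (4 * (N * R + 1)) * R := Finset.sum_le_sum fun j _ => by
          rw [abs_mul]
          exact mul_le_mul (hc j) (hbound z hz j) (abs_nonneg _) (by positivity)
      _ = γ / 4 * (N * R / (N * R + 1)) := by
          rw [Finset.sum_const, Finset.card_univ, nsmul_eq_mul, ← hN]; field_simp
      _ ≤ γ / 4 * 1 := by
          gcongr
          rw [div_le_one (by positivity)]
          linarith
      _ = γ / 4 := mul_one _
  let H : MvPolynomial σ ℝ := G - ∑ j, C (c j) * X j
  have hH : ∀ z, eval z H = eval z G - ∑ j, c j * z j := fun z => by simp [H]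
  obtain ⟨z, hzK, hmax⟩ := hKc.exists_isMaxOn ⟨x, hΩK hxΩ⟩
    (f := fun z => eval z H * eval x G)
    ((MvPolynomial.continuous_eval _).mul continuous_const).continuousOn
  -- At the maximum, the linear form is too small to compensate a zero of `G`.
  have hpos : 0 < eval z G * eval x G := by
    have h1 : eval x H * eval x G ≤ eval z H * eval x G := hmax (hΩK hxΩ)
    rw [hH, hH, sub_mul, sub_mul] at h1
    have h2 : ∀ w ∈ K, |(∑ j, c j * w j) * eval x G| ≤ γ / 4 * γ := fun w hw => by
      rw [abs_mul]
      exact mul_le_mul_of_nonneg_right (hsmall w hw) (abs_nonneg _)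
    have h3 := abs_le.1 (h2 x (hΩK hxΩ))
    have h4 := abs_le.1 (h2 z hzK)
    have h5 : eval x G * eval x G = γ * γ := (abs_mul_abs_self _).symm
    nlinarith
  have hG0 : eval z G ≠ 0 := fun h => by simp [h] at hpos
  have hzΩ : z ∈ Ω := by
    rw [hGe] at hG0
    have h1 := left_ne_zero_of_mul hG0
    have h2 := Finset.prod_ne_zero_iff.1 (right_ne_zero_of_mul hG0)
    refine ⟨lt_of_le_of_ne hzK.1 fun h => h1 (by rw [h, sub_self]), fun i => ?_⟩
    exact lt_of_le_of_ne (hzK.2 i) (mul_ne_zero (h2 i (Finset.mem_univ i)) (hx i)).symm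
  refine ⟨z, hzΩ.2, fun j => ?_⟩
  have hlocal : IsLocalMax (fun t : ℝ => eval (z + t • Pi.single j (1 : ℝ)) H * eval x G) 0 := by
    have hcont : Tendsto (fun t : ℝ => z + t • Pi.single j (1 : ℝ)) (𝓝 0) (𝓝 z) := by
      have : Continuous (fun t : ℝ => z + t • (Pi.single j (1 : ℝ) : σ → ℝ)) := by fun_prop
      simpa using this.tendsto 0
    filter_upwards [hcont (hΩ.mem_nhds hzΩ)] with t ht
    have := hmax (hΩK ht)
    simpa using this
  have hd := hlocal.hasDerivAt_eq_zero ((hasDerivAt_eval_line H z j).mul_const _)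
  have hd' := (mul_eq_zero.1 hd).resolve_right hGx
  have : eval z (pderiv j H) = eval z (pderiv j G) - c j := by
    simp [H, pderiv_X, Pi.single_apply]
  linarith

open MvPolynomial in
/-- A Warren-type bound: `#ι` polynomials of degree at most `d` in `N` real variables have at most
`((2 + #ι d) N + 1) ^ N` strict sign patterns. Each cell contributes a point of one and the same
generic fibre of the gradient of `(R - |x|²) ∏ p_i`. -/
theorem card_le_of_sign_patterns {σ ι κ : Type*} [Fintype σ] [Fintype ι]
    (p : ι → MvPolynomial σ ℝ) (d : ℕ) (hp : ∀ i, (p i).totalDegree ≤ d) (S : Finset κ)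
    (x : κ → σ → ℝ) (h0 : ∀ s ∈ S, ∀ i, eval (x s) (p i) ≠ 0)
    (hsep : ∀ s ∈ S, ∀ t ∈ S, s ≠ t → ∃ i, eval (x s) (p i) * eval (x t) (p i) < 0) :
    S.card ≤ ((2 + Fintype.card ι * d) * Fintype.card σ + 1) ^ Fintype.card σ := by
  classical
  set R : ℝ := 1 + ∑ s ∈ S, ∑ j, x s j ^ 2 with hR
  have hnn : ∀ s ∈ S, 0 ≤ ∑ j, x s j ^ 2 := fun s _ => Finset.sum_nonneg fun j _ => sq_nonneg _
  have hR1 : 1 ≤ R := by have := Finset.sum_nonneg hnn; linarith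
  have hxR : ∀ s ∈ S, ∑ j, x s j ^ 2 < R := fun s hs => by
    have := Finset.single_le_sum hnn hs; linarith
  set G : MvPolynomial σ ℝ := (C R - ∑ j, X j ^ 2) * ∏ i, p i with hG
  have hGdeg : G.totalDegree ≤ 2 + Fintype.card ι * d := by
    refine (totalDegree_mul _ _).trans (add_le_add ?_ ?_)
    · refine (totalDegree_sub _ _).trans (max_le (by simp) (totalDegree_finsetSum_le fun j _ => ?_))
      rw [totalDegree_X_pow]
    · refine (totalDegree_finsetProd _ _).trans ((Finset.sum_le_card_nsmul _ _ d
        fun i _ => hp i).trans ?_)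
      simp
  obtain ⟨B, hB, hBc⟩ := exists_card_fiber_le (fun j => pderiv j G) _
    fun j => (totalDegree_pderiv_le j G).trans hGdeg
  choose! δ hδ hcell using fun s (hs : s ∈ S) =>
    exists_gradient_eq_of_cell p R hR1 (x s) (h0 s hs) (hxR s hs) G hG
  obtain ⟨δ₀, hδ₀, hmin⟩ : ∃ δ₀ > 0, ∀ s ∈ S, δ₀ ≤ δ s := by
    rcases S.eq_empty_or_nonempty with rfl | hS
    · exact ⟨1, one_pos, by simp⟩
    · obtain ⟨s, hs, h⟩ := S.exists_min_image δ hS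
      exact ⟨δ s, hδ s hs, h⟩
  obtain ⟨c, hc, hcB⟩ : ∃ c : σ → ℝ, (∀ j, |c j| ≤ δ₀) ∧ eval c B ≠ 0 := by
    by_contra! h
    refine hB (funext_set (fun _ : σ => Set.Icc (-δ₀) δ₀)
      (fun _ => Set.Icc_infinite (by linarith)) fun c hc => ?_)
    rw [map_zero]
    exact h c fun j => abs_le.2 (hc j (Set.mem_univ j))
  choose! z hz hzc using fun s (hs : s ∈ S) =>
    hcell s hs c fun j => (hc j).trans (hmin s hs)
  have hinj : Set.InjOn z S := by
    intro s hs t ht hst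
    by_contra hne
    obtain ⟨i, hi⟩ := hsep s hs t ht hne
    have h1 := hz s hs i
    have h2 := hz t ht i
    rw [hst] at h1
    have h3 := mul_pos h1 h2
    have h4 : 0 ≤ eval (z t) (p i) * eval (z t) (p i) := mul_self_nonneg _
    nlinarith
  rw [← Finset.card_image_of_injOn hinj]
  refine hBc c hcB _ fun w hw => ?_
  obtain ⟨s, hs, rfl⟩ := Finset.mem_image.1 hw
  exact hzc s hs

/-! ### Counting circuits -/

/-- Complex-valued functions of real variables whose real and imaginary parts are polynomials of
degree at most `d`. -/
def IsPolynomialMap {σ : Type*} (d : ℕ) (f : (σ → ℝ) → ℂ) : Prop :=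
  ∃ p q : MvPolynomial σ ℝ, p.totalDegree ≤ d ∧ q.totalDegree ≤ d ∧
    ∀ x, f x = ⟨MvPolynomial.eval x p, MvPolynomial.eval x q⟩

namespace IsPolynomialMap

variable {σ : Type*} {d e : ℕ} {f g : (σ → ℝ) → ℂ}

theorem const (c : ℂ) : IsPolynomialMap (σ := σ) d fun _ => c :=
  ⟨MvPolynomial.C c.re, MvPolynomial.C c.im, by simp, by simp, fun x => by simp⟩

theorem add (hf : IsPolynomialMap d f) (hg : IsPolynomialMap d g) :
    IsPolynomialMap d fun x => f x + g x := by
  obtain ⟨p, q, hp, hq, h⟩ := hf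
  obtain ⟨p', q', hp', hq', h'⟩ := hg
  refine ⟨p + p', q + q', (MvPolynomial.totalDegree_add _ _).trans (max_le hp hp'),
    (MvPolynomial.totalDegree_add _ _).trans (max_le hq hq'), fun x => ?_⟩
  simp only [h, h']
  apply Complex.ext <;> simp

theorem mul (hf : IsPolynomialMap d f) (hg : IsPolynomialMap e g) :
    IsPolynomialMap (d + e) fun x => f x * g x := by
  obtain ⟨p, q, hp, hq, h⟩ := hf
  obtain ⟨p', q', hp', hq', h'⟩ := hg
  refine ⟨p * p' - q * q', p * q' + q * p', ?_, ?_, fun x => ?_⟩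
  · exact (MvPolynomial.totalDegree_sub _ _).trans (max_le
      ((MvPolynomial.totalDegree_mul _ _).trans (add_le_add hp hp'))
      ((MvPolynomial.totalDegree_mul _ _).trans (add_le_add hq hq')))
  · exact (MvPolynomial.totalDegree_add _ _).trans (max_le
      ((MvPolynomial.totalDegree_mul _ _).trans (add_le_add hp hq'))
      ((MvPolynomial.totalDegree_mul _ _).trans (add_le_add hq hp')))
  · simp only [h, h']
    apply Complex.ext <;> simp

theorem sum {α : Type*} (s : Finset α) {F : α → (σ → ℝ) → ℂ}
    (hF : ∀ a ∈ s, IsPolynomialMap d (F a)) : IsPolynomialMap d fun x => ∑ a ∈ s, F a x := by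
  classical
  induction s using Finset.induction_on with
  | empty => simpa using const 0
  | insert a s ha ih =>
    simp only [Finset.sum_insert ha]
    exact (hF a (Finset.mem_insert_self a s)).add
      (ih fun b hb => hF b (Finset.mem_insert_of_mem hb))

theorem list_prod_apply {n : Type*} [Fintype n] [DecidableEq n]
    (L : List ((σ → ℝ) → Matrix n n ℂ))
    (hL : ∀ A ∈ L, ∀ i j, IsPolynomialMap 1 fun x => A x i j) (i j : n) :
    IsPolynomialMap L.length fun x => (L.map fun A => A x).prod i j := by
  induction L generalizing i with
  | nil => simpa using const _
  | cons A L ih =>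
    simp only [List.map_cons, List.prod_cons, Matrix.mul_apply, List.length_cons]
    rw [add_comm]
    exact sum _ fun k _ => (hL A List.mem_cons_self i k).mul
      (ih (fun B hB => hL B (List.mem_cons_of_mem _ hB)) k)

end IsPolynomialMap

/-- The operator of a circuit with `g` slots, some of which (`none`) may be left empty. -/
noncomputable def slotOp {b g : ℕ} (F : Fin g → Option (PlacedGate b)) : Op b :=
  (List.ofFn fun i => (F i).elim 1 fun G => actOn G.qubits (G.gate : Op 2)).prod

theorem exists_slotOp_eq {b g : ℕ} {K : Set TwoQubitGate} {V : Op b} (hV : V ∈ circuits K b g) :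
    ∃ F : Fin g → Option (PlacedGate b), (∀ i, ∀ G ∈ F i, G.gate ∈ K) ∧ slotOp F = V := by
  obtain ⟨L, hg, hL, rfl⟩ := hV
  induction g generalizing L with
  | zero =>
    obtain rfl : L = [] := List.length_eq_zero_iff.1 (Nat.le_zero.1 hg)
    exact ⟨fun _ => none, by simp, by simp [slotOp, circuitOp]⟩
  | succ g ih =>
    cases L with
    | nil => exact ⟨fun _ => none, by simp, by simp [slotOp, circuitOp]⟩
    | cons G L =>
      obtain ⟨F, hF, hFL⟩ := ih L (by simpa using hg) fun G hG => hL G (List.mem_cons_of_mem _ hG)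
      refine ⟨Fin.cons (some G) F, fun i => ?_, ?_⟩
      · refine Fin.cases ?_ (fun i => ?_) i
        · simpa using hL G List.mem_cons_self
        · simpa using hF i
      · simp only [slotOp, circuitOp] at hFL
        simp [slotOp, circuitOp, List.ofFn_succ, hFL]

theorem placedGate_eq_iff {b : ℕ} {G G' : PlacedGate b} :
    G = G' ↔ (G.qubits, G.gate) = (G'.qubits, G'.gate) := by
  cases G; cases G'; simp

/-- The number of placements of a gate is `b (b - 1) ≤ b ^ 2`. -/
theorem card_embedding_le (b : ℕ) : Fintype.card (Fin 2 ↪ Fin b) ≤ b ^ 2 := by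
  rw [Fintype.card_embedding_eq]
  simpa using Nat.descFactorial_le_pow b 2

/-- Circuits of at most `g` gates from a finite set `K` perform at most `(b² |K| + 1) ^ g`
operators. -/
theorem card_le_of_finite_gates {α : Type*} [Fintype α] {b g : ℕ} {K : Set TwoQubitGate}
    (hK : K.Finite) (V : α → Op b) (hV : ∀ M, V M ∈ circuits K b g)
    (hinj : Function.Injective V) :
    Fintype.card α ≤ (b ^ 2 * K.ncard + 1) ^ g := by
  classical
  choose F hF hFV using fun M => exists_slotOp_eq (hV M)
  let T : Finset ((Fin 2 ↪ Fin b) × TwoQubitGate) := Finset.univ ×ˢ hK.toFinset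
  let code : α → Fin g → Option ((Fin 2 ↪ Fin b) × TwoQubitGate) := fun M i =>
    (F M i).map fun G => (G.qubits, G.gate)
  have hcode : Function.Injective code := fun M M' h => hinj <| by
    rw [← hFV M, ← hFV M']
    congr 1
    funext i
    exact Option.map_injective (fun G G' h => placedGate_eq_iff.2 h) (congrFun h i)
  calc Fintype.card α = (Finset.univ : Finset α).card := rfl
    _ ≤ (Fintype.piFinset fun _ : Fin g => Finset.insertNone T).card :=
        Finset.card_le_card_of_injOn code (fun M _ => by
          simp only [Finset.mem_coe, Fintype.mem_piFinset, Finset.mem_insertNone]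
          rintro i ⟨q, U⟩ h
          obtain ⟨G, hG, hGe⟩ := Option.map_eq_some_iff.1 h
          have := hF M i G hG
          simp only [Prod.mk.injEq] at hGe
          simpa [T, ← hGe.2] using this) hcode.injOn
    _ = (Fintype.card (Fin 2 ↪ Fin b) * K.ncard + 1) ^ g := by
        simp [T, Finset.card_insertNone, Set.ncard_eq_toFinset_card K hK]
    _ ≤ _ := by gcongr; exact card_embedding_le b

/-- The operator of a circuit with prescribed placements `A`, as a function of the real and
imaginary parts of the entries of its gates. -/
noncomputable def paramOp {b g : ℕ} (A : Fin g → Option (Fin 2 ↪ Fin b))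
    (x : Fin g × Bits 2 × Bits 2 × Fin 2 → ℝ) : Op b :=
  (List.ofFn fun i => (A i).elim 1 fun q =>
    actOn q (Matrix.of fun u v => (⟨x (i, u, v, 0), x (i, u, v, 1)⟩ : ℂ))).prod

theorem isPolynomialMap_paramOp {b g : ℕ} (A : Fin g → Option (Fin 2 ↪ Fin b)) (u v : Bits b) :
    IsPolynomialMap g fun x => paramOp A x u v := by
  have := IsPolynomialMap.list_prod_apply
    (List.ofFn fun (i : Fin g) (x : Fin g × Bits 2 × Bits 2 × Fin 2 → ℝ) =>
      (A i).elim (1 : Op b) fun q =>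
        actOn q (Matrix.of fun u v => (⟨x (i, u, v, 0), x (i, u, v, 1)⟩ : ℂ))) ?_ u v
  · simpa [paramOp, List.map_ofFn, Function.comp_def] using this
  · intro B hB u v
    obtain ⟨i, rfl⟩ := (List.mem_ofFn' _ _).1 hB
    cases hA : A i with
    | none =>
      simp only [hA, Option.elim_none]
      exact IsPolynomialMap.const _
    | some q =>
      by_cases h : ∀ k : Fin b, (∀ j : Fin 2, q j ≠ k) → u k = v k
      · simp only [hA, Option.elim_some, actOn, Matrix.of_apply, if_pos h]
        exact ⟨MvPolynomial.X (i, u ∘ q, v ∘ q, 0), MvPolynomial.X (i, u ∘ q, v ∘ q, 1),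
          by simp, by simp, fun x => by simp⟩
      · simp only [hA, Option.elim_some, actOn, Matrix.of_apply, if_neg h]
        exact IsPolynomialMap.const _

/-- The parameters of the gates in the slots of a circuit, `0` for an empty slot. -/
noncomputable def slotParams {b g : ℕ} (F : Fin g → Option (PlacedGate b))
    (s : Fin g × Bits 2 × Bits 2 × Fin 2) : ℝ :=
  (F s.1).elim 0 fun G =>
    if s.2.2.2 = 0 then ((G.gate : Op 2) s.2.1 s.2.2.1).re else ((G.gate : Op 2) s.2.1 s.2.2.1).im

theorem paramOp_slotParams {b g : ℕ} (F : Fin g → Option (PlacedGate b)) :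
    paramOp (fun i => (F i).map PlacedGate.qubits) (slotParams F) = slotOp F := by
  unfold paramOp slotOp
  congr 2
  funext i
  cases h : F i with
  | none => simp [h]
  | some G =>
    simp only [h, Option.map_some, Option.elim_some]
    congr 1
    ext u v
    simp [slotParams, h]

/-- If thresholding the distances to `1` of `#ι` diagonal entries realizes all `2 ^ #ι` patterns on
operators of `g`-gate circuits, then `2 ^ #ι` is at most the number of placements times the bound
on the number of sign patterns of `#ι` polynomials of degree `2 g` in `32 g` variables. -/
theorem two_pow_card_le_of_tests {ι : Type*} [Fintype ι] {b g : ℕ} (V : (ι → Bool) → Op b)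
    (hV : ∀ M, V M ∈ circuits Set.univ b g) (test : ι → Bits b) {ρ : ℝ} (hρ : 0 ≤ ρ)
    (hfalse : ∀ M i, M i = false → ‖V M (test i) (test i) - 1‖ < ρ)
    (htrue : ∀ M i, M i = true → ρ < ‖V M (test i) (test i) - 1‖) :
    2 ^ Fintype.card ι ≤ (b ^ 2 + 1) ^ g *
      ((2 + Fintype.card ι * (2 * g)) * (32 * g) + 1) ^ (32 * g) := by
  classical
  choose F _ hFV using fun M => exists_slotOp_eq (hV M)
  let arch : (ι → Bool) → Fin g → Option (Fin 2 ↪ Fin b) := fun M i => (F M i).map PlacedGate.qubits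
  have hfiber : ∀ A : Fin g → Option (Fin 2 ↪ Fin b),
      (Finset.univ.filter fun M => arch M = A).card ≤
        ((2 + Fintype.card ι * (2 * g)) * (32 * g) + 1) ^ (32 * g) := by
    intro A
    choose p q hp hq hpq using fun i => isPolynomialMap_paramOp A (test i) (test i)
    let P : ι → MvPolynomial (Fin g × Bits 2 × Bits 2 × Fin 2) ℝ := fun i =>
      (p i - MvPolynomial.C 1) ^ 2 + q i ^ 2 - MvPolynomial.C (ρ ^ 2)
    have hPdeg : ∀ i, (P i).totalDegree ≤ 2 * g := by
      intro i
      refine (MvPolynomial.totalDegree_sub_C_le _ _).trans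
        ((MvPolynomial.totalDegree_add _ _).trans (max_le ?_ ?_))
      · exact (MvPolynomial.totalDegree_pow _ _).trans (Nat.mul_le_mul_left _
          ((MvPolynomial.totalDegree_sub_C_le _ _).trans (hp i)))
      · exact (MvPolynomial.totalDegree_pow _ _).trans (Nat.mul_le_mul_left _ (hq i))
    have hP : ∀ M, arch M = A → ∀ i, MvPolynomial.eval (slotParams (F M)) (P i) =
        ‖V M (test i) (test i) - 1‖ ^ 2 - ρ ^ 2 := by
      rintro M rfl i
      have hVM : V M (test i) (test i) =
          ⟨MvPolynomial.eval (slotParams (F M)) (p i), MvPolynomial.eval (slotParams (F M)) (q i)⟩ := by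
        rw [← hFV M, ← paramOp_slotParams]
        exact hpq i (slotParams (F M))
      rw [hVM, ← Complex.normSq_eq_norm_sq, Complex.normSq_apply]
      simp [P]
      ring
    have hneg : ∀ M, arch M = A → ∀ i, M i = false →
        MvPolynomial.eval (slotParams (F M)) (P i) < 0 := fun M hM i hi => by
      rw [hP M hM, sub_neg]
      exact pow_lt_pow_left₀ (hfalse M i hi) (norm_nonneg _) two_ne_zero
    have hpos : ∀ M, arch M = A → ∀ i, M i = true →
        0 < MvPolynomial.eval (slotParams (F M)) (P i) := fun M hM i hi => by
      rw [hP M hM, sub_pos]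
      exact pow_lt_pow_left₀ (htrue M i hi) hρ two_ne_zero
    have := card_le_of_sign_patterns P (2 * g) hPdeg (Finset.univ.filter fun M => arch M = A)
      (fun M => slotParams (F M)) ?_ ?_
    · have hcard : Fintype.card (Fin g × Bits 2 × Bits 2 × Fin 2) = 32 * g := by
        simp; ring
      rwa [hcard] at this
    · intro M hM i
      have hM := (Finset.mem_filter.1 hM).2
      cases h : M i with
      | false => exact (hneg M hM i h).ne
      | true => exact (hpos M hM i h).ne'
    · intro M hM M' hM' hne
      have hM := (Finset.mem_filter.1 hM).2
      have hM' := (Finset.mem_filter.1 hM').2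
      obtain ⟨i, hi⟩ := Function.ne_iff.1 hne
      refine ⟨i, ?_⟩
      cases h : M i with
      | false =>
        have h' : M' i = true := by simpa [h] using hi
        exact mul_neg_of_neg_of_pos (hneg M hM i h) (hpos M' hM' i h')
      | true =>
        have h' : M' i = false := by simpa [h] using hi
        exact mul_neg_of_pos_of_neg (hpos M hM i h) (hneg M' hM' i h')
  have h := Finset.card_le_mul_card_image_of_maps_to (s := (Finset.univ : Finset (ι → Bool)))
    (t := Finset.univ) (f := arch) (fun _ _ => Finset.mem_univ _) _ fun A _ => hfiber A
  rw [Finset.card_univ, Finset.card_univ, Fintype.card_fun, Fintype.card_fun, Fintype.card_bool,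
    Fintype.card_option, Fintype.card_fin] at h
  refine h.trans ((mul_comm _ _).trans_le (Nat.mul_le_mul_right _ (Nat.pow_le_pow_left ?_ _)))
  exact Nat.succ_le_succ (card_embedding_le b)

/-! ### Hamiltonians that encode bits -/

section Norm

open scoped Matrix.Norms.L2Operator

theorem norm_apply_le_opNorm {m n : ℕ} (A : Matrix (Bits m) (Bits n) ℂ) (x : Bits m)
    (y : Bits n) : ‖A x y‖ ≤ opNorm A := by
  have h := A.l2_opNorm_mulVec (EuclideanSpace.single y 1)
  rw [show ‖EuclideanSpace.single y (1 : ℂ)‖ = 1 by simp, mul_one] at h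
  refine le_trans ?_ h
  have := PiLp.norm_apply_le ((EuclideanSpace.equiv (Bits m) ℂ).symm
    (A.mulVec (EuclideanSpace.single y (1 : ℂ)))) x
  simpa using this

end Norm

/-- The eigenvalue of `hamiltonian β` at the basis state `x`. -/
def energy {n : ℕ} (β : Fin n → Fin n → ℝ) (x : Bits n) : ℝ :=
  ∑ j : Fin n, ∑ k ∈ Finset.Ioi j, β j k * ((-1) ^ (x j : ℕ) * (-1) ^ (x k : ℕ))

theorem hamiltonian_eq_diagonal {n : ℕ} (β : Fin n → Fin n → ℝ) :
    hamiltonian β = Matrix.diagonal fun x => (energy β x : ℂ) := by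
  ext x y
  by_cases h : x = y
  · subst h
    simp [hamiltonian, Matrix.sum_apply, pauliZ, energy]
  · simp [hamiltonian, Matrix.sum_apply, pauliZ, h]

theorem evolution_apply_self {n : ℕ} (β : Fin n → Fin n → ℝ) (x : Bits n) :
    evolution β x x = Complex.exp (Complex.I * ((-energy β x : ℝ) : ℂ)) := by
  rw [evolution, hamiltonian_eq_diagonal, ← Matrix.diagonal_smul, Matrix.exp_diagonal,
    Matrix.diagonal_apply_eq, Pi.coe_exp, ← Complex.exp_eq_exp_ℂ]
  simp

/-- The basis state `|x⟩ ⊗ |0…0⟩`. -/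
def padZero {n b : ℕ} (x : Bits n) : Bits b := fun i => if h : (i : ℕ) < n then x ⟨i, h⟩ else 0

theorem padZero_comp_castLE {n b : ℕ} (hb : n ≤ b) (x : Bits n) :
    (padZero x : Bits b) ∘ Fin.castLE hb = x := by
  ext i
  simp [padZero]

theorem comp_castLE_eq_and_iff_eq_padZero {n b : ℕ} (hb : n ≤ b) (x : Bits n) (y : Bits b) :
    (y ∘ Fin.castLE hb = x ∧ ∀ i : Fin b, n ≤ (i : ℕ) → y i = 0) ↔ y = padZero x := by
  constructor
  · rintro ⟨rfl, h⟩
    funext i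
    by_cases hi : (i : ℕ) < n
    · simp only [padZero, hi, dif_pos, Function.comp_apply]
      rfl
    · simp [padZero, hi, h i (not_lt.1 hi)]
  · rintro rfl
    exact ⟨padZero_comp_castLE hb x, fun i hi => by simp [padZero, not_lt.2 hi]⟩

theorem actOn_castLEEmb_apply_padZero {n b : ℕ} (hb : n ≤ b) (U : Op n) (x : Bits n) :
    actOn (Fin.castLEEmb hb) U (padZero x) (padZero x) = U x x := by
  simp only [actOn, Matrix.of_apply, Fin.coe_castLEEmb, padZero_comp_castLE]
  simp

theorem zeroAncilla_mul_apply_padZero {n b : ℕ} (hb : n ≤ b) (U : Op n) (x : Bits n) :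
    (zeroAncilla hb * U) (padZero x) x = U x x := by
  have h : ∀ y : Bits n, zeroAncilla hb (padZero x) y = if x = y then 1 else 0 := fun y => by
    simp only [zeroAncilla, Matrix.of_apply, padZero_comp_castLE]
    exact if_congr ⟨And.left, fun h => ⟨h, fun i hi => by simp [padZero, not_lt.2 hi]⟩⟩ rfl rfl
  simp [Matrix.mul_apply, h]

theorem mul_zeroAncilla_apply {n b : ℕ} (hb : n ≤ b) (V : Op b) (x : Bits n) :
    (V * zeroAncilla hb) (padZero x) x = V (padZero x) (padZero x) := by
  simp [Matrix.mul_apply, zeroAncilla, comp_castLE_eq_and_iff_eq_padZero hb]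

/-- With or without ancillas, the circuits have to reproduce the phases of `e^{-iH}`. -/
theorem exists_circuit_of_mem {n b g : ℕ} {K : Set TwoQubitGate} {hb : n ≤ b} {t ε : ℝ}
    (hg : g ∈ sufficientGates K hb t ε ∪ sufficientGatesAncilla K hb t ε)
    (β : Fin n → Fin n → ℝ) (hβ : ∀ j k, j < k → |β j k| ≤ t) :
    ∃ V ∈ circuits K b g, ∀ x : Bits n,
      ‖Complex.exp (Complex.I * ((-energy β x : ℝ) : ℂ)) - V (padZero x) (padZero x)‖ ≤ ε := by
  rcases hg with hg | hg
  · obtain ⟨V, hV, h⟩ := hg β hβ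
    refine ⟨V, hV, fun x => le_trans ?_ ((norm_apply_le_opNorm _ (padZero x) (padZero x)).trans h)⟩
    rw [Matrix.sub_apply, actOn_castLEEmb_apply_padZero, evolution_apply_self]
  · obtain ⟨V, hV, h⟩ := hg β hβ
    refine ⟨V, hV, fun x => le_trans ?_ ((norm_apply_le_opNorm _ (padZero x) x).trans h)⟩
    rw [Matrix.sub_apply, zeroAncilla_mul_apply_padZero, mul_zeroAncilla_apply,
      evolution_apply_self]

/-- The vector supported on the `B`-th block of `2 L` consecutive qubits, with alternating
signs. -/
def blockSign (L B j : ℕ) : ℝ := if j / (2 * L) = B then (-1) ^ j else 0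

/-- The couplings that encode the bit `M (J, K)` in the interaction of the blocks `J` and `m + K`.
The alternating signs cancel all contributions of a block whose qubits are in the same state. -/
def blockCoupling {n : ℕ} (m L : ℕ) (s : ℝ) (M : Fin m × Fin m → Bool) (j k : Fin n) : ℝ :=
  ∑ q : Fin m × Fin m, (if M q then s else 0) * (blockSign L q.1 j * blockSign L (m + q.2) k)

/-- A qubit lies in at most one block. -/
theorem sum_abs_blockSign_le {ι : Type*} [Fintype ι] (L j : ℕ) (B : ι → ℕ)
    (hB : Function.Injective B) : ∑ J, |blockSign L (B J) j| ≤ 1 := by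
  classical
  by_cases h : ∃ J₀, j / (2 * L) = B J₀
  · obtain ⟨J₀, h⟩ := h
    rw [Finset.sum_eq_single J₀]
    · simp [blockSign, h]
    · intro J _ hJ
      simp [blockSign, h, hB.eq_iff, hJ.symm]
    · simp
  · push Not at h
    rw [Finset.sum_eq_zero fun J _ => by simp [blockSign, h J]]
    exact zero_le_one

theorem abs_blockCoupling_le {n m L : ℕ} {s : ℝ} (hs : 0 ≤ s) (M : Fin m × Fin m → Bool)
    (j k : Fin n) : |blockCoupling m L s M j k| ≤ s := by
  calc |blockCoupling m L s M j k|
      ≤ ∑ q : Fin m × Fin m, s * (|blockSign L q.1 j| * |blockSign L (m + q.2) k|) := by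
        refine (Finset.abs_sum_le_sum_abs _ _).trans (Finset.sum_le_sum fun q _ => ?_)
        rw [abs_mul, abs_mul]
        refine mul_le_mul_of_nonneg_right ?_ (by positivity)
        split_ifs <;> simp [abs_of_nonneg, hs]
    _ = s * ((∑ J : Fin m, |blockSign L J j|) * ∑ K : Fin m, |blockSign L (m + K) k|) := by
        rw [← Finset.mul_sum, Fintype.sum_prod_type, Finset.sum_mul_sum]
    _ ≤ s * (1 * 1) := by
        refine mul_le_mul_of_nonneg_left (mul_le_mul ?_ ?_ ?_ zero_le_one) hs
        · exact sum_abs_blockSign_le L j (fun J : Fin m => (J : ℕ)) Fin.val_injective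
        · exact sum_abs_blockSign_le L k (fun K : Fin m => m + (K : ℕ)) fun a b h => by
            apply Fin.ext
            simpa using h
        · positivity
    _ = s := by ring

/-- The couplings are bilinear in the block vectors, hence so is the energy. -/
theorem energy_blockCoupling {n m L : ℕ} (s : ℝ) (M : Fin m × Fin m → Bool) (x : Bits n) :
    energy (blockCoupling m L s M) x = ∑ q : Fin m × Fin m, (if M q then s else 0) *
      ((∑ j : Fin n, blockSign L q.1 j * (-1) ^ (x j : ℕ)) *
        ∑ k : Fin n, blockSign L (m + q.2) k * (-1) ^ (x k : ℕ)) := by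
  -- The coupling vanishes unless `j` precedes `k`, as the block of `j` precedes that of `k`.
  have hIoi : ∀ j : Fin n, ∑ k ∈ Finset.Ioi j,
      blockCoupling m L s M j k * ((-1) ^ (x j : ℕ) * (-1) ^ (x k : ℕ)) =
      ∑ k, blockCoupling m L s M j k * ((-1) ^ (x j : ℕ) * (-1) ^ (x k : ℕ)) := by
    intro j
    refine Finset.sum_subset (Finset.subset_univ _) fun k _ hk => ?_
    have hkj : k ≤ j := by simpa using hk
    have : blockCoupling m L s M j k = 0 := by
      refine Finset.sum_eq_zero fun q _ => ?_
      by_cases h1 : (j : ℕ) / (2 * L) = q.1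
      · have h2 : (k : ℕ) / (2 * L) ≠ m + q.2 := by
          have : (k : ℕ) / (2 * L) ≤ j / (2 * L) := Nat.div_le_div_right hkj
          have := q.1.isLt
          omega
        simp [blockSign, h2]
      · simp [blockSign, h1]
    rw [this, zero_mul]
  calc energy (blockCoupling m L s M) x
      = ∑ j : Fin n, ∑ k : Fin n, ∑ q : Fin m × Fin m, (if M q then s else 0) *
          ((blockSign L q.1 j * (-1) ^ (x j : ℕ)) *
            (blockSign L (m + q.2) k * (-1) ^ (x k : ℕ))) := by
        refine Finset.sum_congr rfl fun j _ => (hIoi j).trans (Finset.sum_congr rfl fun k _ => ?_)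
        rw [blockCoupling, Finset.sum_mul]
        exact Finset.sum_congr rfl fun q _ => by ring
    _ = ∑ q : Fin m × Fin m, ∑ j : Fin n, ∑ k : Fin n, (if M q then s else 0) *
          ((blockSign L q.1 j * (-1) ^ (x j : ℕ)) *
            (blockSign L (m + q.2) k * (-1) ^ (x k : ℕ))) := by
        exact (Finset.sum_congr rfl fun j _ => Finset.sum_comm).trans Finset.sum_comm
    _ = _ := by
        refine Finset.sum_congr rfl fun q _ => ?_
        rw [Finset.sum_mul_sum, Finset.mul_sum]
        exact Finset.sum_congr rfl fun j _ => (Finset.mul_sum _ _ _).symm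

theorem sum_block {n L B : ℕ} (hL : 0 < L) (hB : 2 * L * (B + 1) ≤ n) (F : ℕ → ℝ) :
    ∑ j : Fin n, (if (j : ℕ) / (2 * L) = B then F j else 0) =
      ∑ i ∈ Finset.range (2 * L), F (2 * L * B + i) := by
  rw [Fin.sum_univ_eq_sum_range (fun j => if j / (2 * L) = B then F j else 0) n,
    ← Finset.sum_filter]
  have : (Finset.range n).filter (fun j => j / (2 * L) = B) =
      Finset.Ico (2 * L * B) (2 * L * (B + 1)) := by
    ext j
    rw [Finset.mem_filter, Finset.mem_range, Finset.mem_Ico,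
      Nat.div_eq_iff (by omega), mul_comm B, mul_add, mul_one]
    rw [mul_add, mul_one] at hB
    generalize 2 * L * B = a at hB ⊢
    omega
  rw [this, Finset.sum_Ico_eq_sum_range]
  congr 2
  rw [mul_add, mul_one, Nat.add_sub_cancel_left]

/-- The state in which exactly the even qubits of the blocks `J` and `m + K` are flipped. -/
def testBits {n : ℕ} (m L : ℕ) (q : Fin m × Fin m) : Bits n := fun i =>
  if ((i : ℕ) / (2 * L) = q.1 ∨ (i : ℕ) / (2 * L) = m + q.2) ∧ Even (i : ℕ) then 1 else 0

theorem sum_blockSign_testBits {n m L B : ℕ} (hL : 0 < L) (hB : 2 * L * (B + 1) ≤ n)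
    (q : Fin m × Fin m) :
    ∑ j : Fin n, blockSign L B j * (-1) ^ ((testBits m L q : Bits n) j : ℕ) =
      if B = q.1 ∨ B = m + q.2 then -(2 * L : ℝ) else 0 := by
  have h : ∀ j : Fin n, blockSign L B j * (-1) ^ ((testBits m L q : Bits n) j : ℕ) =
      if (j : ℕ) / (2 * L) = B then
        (if B = q.1 ∨ B = m + q.2 then -1 else (-1 : ℝ) ^ (j : ℕ)) else 0 := by
    intro j
    by_cases hj : (j : ℕ) / (2 * L) = B
    · by_cases hBq : B = q.1 ∨ B = m + q.2
      · rcases Nat.even_or_odd (j : ℕ) with he | ho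
        · simp [blockSign, testBits, hj, hBq, he]
        · simp [blockSign, testBits, hj, hBq, ho, Nat.not_even_iff_odd.2 ho]
      · simp [blockSign, testBits, hj, hBq]
    · simp [blockSign, hj]
  simp only [h]
  rw [sum_block hL hB (fun j => if B = q.1 ∨ B = m + q.2 then -1 else (-1 : ℝ) ^ j)]
  split_ifs
  · simp
  · have : ∀ i, (-1 : ℝ) ^ (2 * L * B + i) = (-1) ^ i := fun i => by
      rw [pow_add, mul_assoc, pow_mul]; simp
    simp only [this]
    rw [neg_one_geom_sum, if_pos (even_two_mul L)]

theorem energy_blockCoupling_testBits {n m L : ℕ} (hL : 0 < L) (hn : 4 * L * m ≤ n) (s : ℝ)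
    (M : Fin m × Fin m → Bool) (q : Fin m × Fin m) :
    energy (blockCoupling m L s M) (testBits m L q : Bits n) =
      if M q then 4 * (L : ℝ) ^ 2 * s else 0 := by
  have hblock : ∀ B < 2 * m, 2 * L * (B + 1) ≤ n := fun B hB => by nlinarith
  rw [energy_blockCoupling, Finset.sum_eq_single q]
  · have h1 := q.1.isLt
    have h2 := q.2.isLt
    rw [sum_blockSign_testBits hL (hblock _ (by omega)),
      sum_blockSign_testBits hL (hblock _ (by omega))]
    simp only [true_or, or_true, if_true]
    split_ifs <;> ring
  · rintro ⟨J, K⟩ _ hne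
    have h1 := q.1.isLt
    have h2 := q.2.isLt
    have h3 := J.isLt
    have h4 := K.isLt
    rw [sum_blockSign_testBits hL (hblock _ (by simp; omega)),
      sum_blockSign_testBits hL (hblock _ (by simp; omega))]
    by_cases hJ : J = q.1
    · have hK : K ≠ q.2 := fun hK => hne (Prod.ext hJ hK)
      have : ¬ (m + (K : ℕ) = q.1 ∨ m + (K : ℕ) = m + q.2) := by
        rw [Ne, Fin.ext_iff] at hK
        omega
      simp only [if_neg this, mul_zero]
    · have : ¬ ((J : ℕ) = q.1 ∨ (J : ℕ) = m + q.2) := by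
        rw [Fin.ext_iff] at hJ
        omega
      simp only [if_neg this, zero_mul, mul_zero]
  · simp

/-- Thresholding the diagonal entries of the circuits at distance `2 ε` from `1` reads off every
pattern of `m ^ 2` bits. -/
theorem exists_circuits_with_tests {n b m L g : ℕ} {K : Set TwoQubitGate} {hb : n ≤ b} {t ε : ℝ}
    (hL : 0 < L) (hn : 4 * L * m ≤ n) (hε : 0 < ε) (hε' : ε < 1 / 3)
    (ht : Real.pi * ε / (2 * (L : ℝ) ^ 2) ≤ t)
    (hg : g ∈ sufficientGates K hb t ε ∪ sufficientGatesAncilla K hb t ε) :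
    ∃ (V : (Fin m × Fin m → Bool) → Op b) (test : Fin m × Fin m → Bits b),
      (∀ M, V M ∈ circuits K b g) ∧
      (∀ M q, M q = false → ‖V M (test q) (test q) - 1‖ < 2 * ε) ∧
      ∀ M q, M q = true → 2 * ε < ‖V M (test q) (test q) - 1‖ := by
  have hL' : (0 : ℝ) < L := by exact_mod_cast hL
  set s := Real.pi * ε / (2 * (L : ℝ) ^ 2) with hs
  have hs0 : 0 ≤ s := by have := Real.pi_pos; positivity
  have hsL : 4 * (L : ℝ) ^ 2 * s = 2 * Real.pi * ε := by rw [hs]; field_simp; ring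
  choose V hV hVx using fun M : Fin m × Fin m → Bool =>
    exists_circuit_of_mem hg (blockCoupling m L s M)
      fun j k _ => (abs_blockCoupling_le hs0 M j k).trans ht
  refine ⟨V, fun q => padZero (testBits m L q : Bits n), hV, fun M q hq => ?_, fun M q hq => ?_⟩
  · have := hVx M (testBits m L q)
    rw [energy_blockCoupling_testBits hL hn, hq] at this
    simp only [Bool.false_eq_true, if_false, neg_zero, Complex.ofReal_zero, mul_zero,
      Complex.exp_zero] at this
    rw [norm_sub_rev]
    linarith
  · have := hVx M (testBits m L q)
    rw [energy_blockCoupling_testBits hL hn, hq, if_pos rfl, hsL] at this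
    have hphase : 4 * ε ≤ ‖Complex.exp (Complex.I * ((-(2 * Real.pi * ε) : ℝ) : ℂ)) - 1‖ := by
      rw [Complex.norm_exp_I_mul_ofReal_sub_one, Real.norm_eq_abs,
        show -(2 * Real.pi * ε) / 2 = -(Real.pi * ε) by ring, Real.sin_neg, mul_neg, abs_neg]
      have hpi := Real.pi_pos
      have := Real.mul_le_sin (x := Real.pi * ε) (by positivity) (by nlinarith)
      have h2 : 2 / Real.pi * (Real.pi * ε) = 2 * ε := by field_simp
      exact le_trans (by linarith) (le_abs_self _)
    have htri := norm_sub_le_norm_sub_add_norm_sub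
      (Complex.exp (Complex.I * ((-(2 * Real.pi * ε) : ℝ) : ℂ)))
      (V M (padZero (testBits m L q : Bits n)) (padZero (testBits m L q : Bits n))) 1
    linarith

/-! ### Combining the bounds -/

/-- If encoding the `⌊n / 4 L⌋ ^ 2` bits takes a circuit with `O(g log X)` bits of description,
then `g` obeys the lower bound; for `n < 8 L` the bound is not positive. The
constant `451 = 3 + 32 * 14` comes from `sq_mul_log_two_le_of_univ`. -/
theorem lower_bound_of_sq_le {n L g : ℕ} (hL : 0 < L) {X : ℝ} (hX : 2 ≤ X) (Y : ℝ)
    (h : ((n / (4 * L) : ℕ) : ℝ) ^ 2 * Real.log 2 ≤ 451 * g * Real.log X) :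
    Real.log 2 / (64 * (L : ℝ) ^ 2 * 451) *
      ((n : ℝ) ^ 2 / Real.log X - 8 * L / Real.log 2 * n * Y ^ 0) ≤ g := by
  have hlog2 : 0 < Real.log 2 := Real.log_pos one_lt_two
  have hlogX : Real.log 2 ≤ Real.log X := Real.log_le_log two_pos hX
  have hX0 : 0 < Real.log X := hlog2.trans_le hlogX
  have hL' : (0 : ℝ) < L := by exact_mod_cast hL
  rw [pow_zero, mul_one]
  rcases lt_or_ge n (8 * L) with hn | hn
  · have hn' : (n : ℝ) ≤ 8 * L := by exact_mod_cast hn.le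
    have : (n : ℝ) ^ 2 / Real.log X ≤ 8 * L / Real.log 2 * n := by
      calc (n : ℝ) ^ 2 / Real.log X ≤ (n : ℝ) ^ 2 / Real.log 2 := by gcongr
        _ ≤ (8 * L * n) / Real.log 2 := by
          rw [sq]
          gcongr
        _ = _ := by ring
    exact (mul_nonpos_of_nonneg_of_nonpos (by positivity) (by linarith)).trans (Nat.cast_nonneg g)
  · set m := n / (4 * L) with hm
    have h1 : n ≤ 8 * L * m := by
      have := Nat.lt_mul_div_succ n (b := 4 * L) (by omega)
      rw [← hm] at this
      nlinarith
    have h1' : (n : ℝ) ≤ 8 * L * m := by exact_mod_cast h1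
    have h2 : (n : ℝ) ^ 2 * Real.log 2 ≤ 64 * (L : ℝ) ^ 2 * 451 * (g * Real.log X) := by
      calc (n : ℝ) ^ 2 * Real.log 2 ≤ (8 * L * m) ^ 2 * Real.log 2 := by gcongr
        _ = 64 * (L : ℝ) ^ 2 * ((m : ℝ) ^ 2 * Real.log 2) := by ring
        _ ≤ 64 * (L : ℝ) ^ 2 * (451 * g * Real.log X) := by gcongr
        _ = _ := by ring
    calc _ ≤ Real.log 2 / (64 * (L : ℝ) ^ 2 * 451) * ((n : ℝ) ^ 2 / Real.log X) := by
          gcongr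
          have : 0 ≤ 8 * L / Real.log 2 * n := by positivity
          linarith
      _ ≤ g := by
          rw [div_mul_div_comm, div_le_iff₀ (by positivity)]
          linarith

theorem sq_mul_log_two_le_of_finite {b k m g : ℕ} (hb : 2 ≤ b) (hk : 1 ≤ k)
    (h : 2 ^ (m * m) ≤ (b ^ 2 * k + 1) ^ g) :
    (m : ℝ) ^ 2 * Real.log 2 ≤ 451 * g * Real.log ((b : ℝ) * k) := by
  have hbk : 2 ≤ b * k := by nlinarith
  have h1 : b ^ 2 * k + 1 ≤ (b * k) ^ 3 := by
    calc b ^ 2 * k + 1 ≤ (b * k) ^ 2 + (b * k) ^ 2 := by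
          gcongr
          · rw [mul_pow]
            exact Nat.mul_le_mul_left _ (Nat.le_self_pow two_ne_zero k)
          · exact Nat.one_le_pow _ _ (by omega)
      _ = (b * k) ^ 2 * 2 := by ring
      _ ≤ (b * k) ^ 2 * (b * k) := by gcongr
      _ = (b * k) ^ 3 := by ring
  have h2 : 2 ^ (m * m) ≤ (b * k) ^ (3 * g) := by
    rw [pow_mul (b * k)]
    exact h.trans (Nat.pow_le_pow_left h1 g)
  have h3 : ((2 : ℝ)) ^ (m * m) ≤ ((b : ℝ) * k) ^ (3 * g) := by exact_mod_cast h2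
  have h4 := Real.log_le_log (by positivity) h3
  rw [Real.log_pow, Real.log_pow] at h4
  push_cast at h4
  have h5 : 0 ≤ g * Real.log ((b : ℝ) * k) :=
    mul_nonneg (Nat.cast_nonneg _) (Real.log_nonneg (by exact_mod_cast (by omega : 1 ≤ b * k)))
  nlinarith

theorem sq_mul_log_two_le_of_univ {n b m g : ℕ} (hn : 2 ≤ n) (hb : n ≤ b) (hm : m ≤ n)
    (h : 2 ^ (m * m) ≤ (b ^ 2 + 1) ^ g *
      ((2 + m * m * (2 * g)) * (32 * g) + 1) ^ (32 * g)) :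
    (m : ℝ) ^ 2 * Real.log 2 ≤ 451 * g * Real.log b := by
  have hb2 : 2 ≤ b := hn.trans hb
  have hb2' : (2 : ℝ) ≤ b := by exact_mod_cast hb2
  have hlog2 : 0 < Real.log 2 := Real.log_pos one_lt_two
  have hlogb : Real.log 2 ≤ Real.log b := Real.log_le_log two_pos hb2'
  -- If `g` exceeds `n ^ 2`, the inequality is immediate; otherwise `g` is polynomial in `b`, and so is
  -- the base of the bound on sign patterns.
  rcases le_total g (n ^ 2) with hg | hg
  · have hgb : g ≤ b ^ 2 := hg.trans (Nat.pow_le_pow_left hb 2)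
    have hmb : m * m ≤ b ^ 2 := by
      rw [sq]
      exact Nat.mul_le_mul (hm.trans hb) (hm.trans hb)
    have hb4 : 1 ≤ b ^ 4 := Nat.one_le_pow _ _ (by omega)
    have hb6 : 1 ≤ b ^ 6 := Nat.one_le_pow _ _ (by omega)
    have h1 : (2 + m * m * (2 * g)) * (32 * g) + 1 ≤ b ^ 14 := by
      calc (2 + m * m * (2 * g)) * (32 * g) + 1
          ≤ (2 + b ^ 2 * (2 * b ^ 2)) * (32 * b ^ 2) + 1 := by gcongr
        _ = 64 * b ^ 2 + 64 * b ^ 6 + 1 := by ring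
        _ ≤ 64 * b ^ 6 + 64 * b ^ 6 + b ^ 6 := by
          gcongr <;> omega
        _ ≤ 2 ^ 8 * b ^ 6 := by omega
        _ ≤ b ^ 8 * b ^ 6 := by gcongr
        _ = b ^ 14 := by ring
    have h2 : b ^ 2 + 1 ≤ b ^ 3 := by
      have : 1 ≤ b ^ 2 := Nat.one_le_pow _ _ (by omega)
      calc b ^ 2 + 1 ≤ b ^ 2 * 2 := by omega
        _ ≤ b ^ 2 * b := by gcongr
        _ = b ^ 3 := by ring
    have h3 : 2 ^ (m * m) ≤ b ^ (451 * g) := by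
      calc _ ≤ _ := h
        _ ≤ (b ^ 3) ^ g * (b ^ 14) ^ (32 * g) := by gcongr
        _ = b ^ (451 * g) := by rw [← pow_mul, ← pow_mul, ← pow_add]; congr 1; ring
    have h4 : ((2 : ℝ)) ^ (m * m) ≤ (b : ℝ) ^ (451 * g) := by exact_mod_cast h3
    have h5 := Real.log_le_log (by positivity) h4
    rw [Real.log_pow, Real.log_pow] at h5
    push_cast at h5
    linarith
  · have hg' : (n : ℝ) ^ 2 ≤ g := by exact_mod_cast hg
    calc (m : ℝ) ^ 2 * Real.log 2 ≤ (n : ℝ) ^ 2 * Real.log 2 := by gcongr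
      _ ≤ g * Real.log b := by gcongr
      _ ≤ 451 * g * Real.log b := by
        have : 0 ≤ g * Real.log b := mul_nonneg (Nat.cast_nonneg _) (hlog2.le.trans hlogb)
        linarith

end QCircuit

theorem mainTheorem1 :
    ∀ a : ℝ, 0 < a → ∃ c : ℝ, 0 < c ∧ ∃ C : ℝ, 0 < C ∧ ∃ r : ℕ,
      ∀ (n b : ℕ) (_ : 2 ≤ n) (hb : n ≤ b) (ε t : ℝ), 0 < ε → ε < 1 / 3 → a * ε ≤ t →
        (∀ K : Set QCircuit.TwoQubitGate, K.Finite → K.Nonempty →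
          ∀ g ∈ QCircuit.sufficientGates K hb t ε ∪ QCircuit.sufficientGatesAncilla K hb t ε,
            c * ((n : ℝ) ^ 2 / Real.log ((b : ℝ) * (K.ncard : ℝ))
              - C * (n : ℝ) * Real.log ((n : ℝ) / ε) ^ r) ≤ (g : ℝ)) ∧
        (∀ g ∈ QCircuit.sufficientGates Set.univ hb t ε ∪
            QCircuit.sufficientGatesAncilla Set.univ hb t ε,
          c * ((n : ℝ) ^ 2 / Real.log (b : ℝ)
            - C * (n : ℝ) * Real.log ((n : ℝ) / ε) ^ r) ≤ (g : ℝ)) := by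
  intro a ha
  set L := ⌈2 / a⌉₊ + 1 with hLdef
  have hL : 0 < L := Nat.succ_pos _
  have hL' : (0 : ℝ) < L := by exact_mod_cast hL
  have hlog2 : 0 < Real.log 2 := Real.log_pos one_lt_two
  -- Blocks of `2 L` qubits bring couplings of size at most `a ε` up to a phase `2 π ε`.
  have hLa : Real.pi / (2 * (L : ℝ) ^ 2) ≤ a := by
    have h1 : 2 ≤ a * L := by
      have h2 : 2 / a ≤ L := (Nat.le_ceil _).trans (by rw [hLdef]; push_cast; linarith)
      rwa [div_le_iff₀' ha] at h2
    have h3 : (1 : ℝ) ≤ L := by exact_mod_cast hL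
    rw [div_le_iff₀ (by positivity)]
    nlinarith [Real.pi_le_four, mul_le_mul_of_nonneg_right h1 hL'.le]
  -- The exponent `r = 0` suffices: the subtracted term only has to dominate for `n < 8 L`.
  refine ⟨Real.log 2 / (64 * (L : ℝ) ^ 2 * 451), by positivity, 8 * L / Real.log 2, by positivity,
    0, fun n b hn hb ε t hε hε' hat => ?_⟩
  have ht : Real.pi * ε / (2 * (L : ℝ) ^ 2) ≤ t := by
    calc Real.pi * ε / (2 * (L : ℝ) ^ 2) = Real.pi / (2 * (L : ℝ) ^ 2) * ε := by ring
      _ ≤ a * ε := by gcongr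
      _ ≤ t := hat
  have hb2 : 2 ≤ b := hn.trans hb
  have hnm : 4 * L * (n / (4 * L)) ≤ n := Nat.mul_div_le n (4 * L)
  refine ⟨fun K hK hKne g hg => ?_, fun g hg => ?_⟩
  · have hk : 1 ≤ K.ncard := (Set.ncard_pos hK).2 hKne
    obtain ⟨V, test, hV, hf, hT⟩ := QCircuit.exists_circuits_with_tests hL hnm hε hε' ht hg
    refine QCircuit.lower_bound_of_sq_le hL (by exact_mod_cast (by nlinarith : 2 ≤ b * K.ncard)) _
      (QCircuit.sq_mul_log_two_le_of_finite hb2 hk ?_)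
    have hinj : Function.Injective V := fun M M' h => by
      funext q
      cases hM : M q <;> cases hM' : M' q
      · rfl
      · exact absurd (hf M q hM) (by rw [h]; exact (hT M' q hM').not_gt)
      · exact absurd (hT M q hM) (by rw [h]; exact (hf M' q hM').not_gt)
      · rfl
    simpa using QCircuit.card_le_of_finite_gates hK V hV hinj
  · obtain ⟨V, test, hV, hf, hT⟩ := QCircuit.exists_circuits_with_tests hL hnm hε hε' ht hg
    refine QCircuit.lower_bound_of_sq_le hL (by exact_mod_cast hb2) _
      (QCircuit.sq_mul_log_two_le_of_univ hn hb (Nat.div_le_self _ _) ?_)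
    simpa using QCircuit.two_pow_card_le_of_tests V hV test (by positivity) hf hT
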